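/- Let $f:\mathbb{R}^n\to\mathbb{R}^n$ be such that the system $y'=f(y)$ has finitely many equilibria (points $y^*$ with $f(y^*)=0$), $f$ is continuously differentiable in a neighbourhood of each of them, and each of them is hyperbolic, i.e. no (complex) eigenvalue of the Jacobian matrix $J(y^*)=\frac{\partial f}{\partial y}(y^*)$ lies on the imaginary axis. An equilibrium $y^*$ of $y'=f(y)$ is called stable if for every $\varepsilon>0$ there is $\delta>0$ such that for every $y_0$ with $\|y_0-y^*\|<\delta$ a solution on $[0,\infty)$ with $y(0)=y_0$ exists, and every such solution satisfies $\|y(t)-y^*\|<\varepsilon$ for all $t\ge 0$; unstable if it is not stable; and locally asymptotically stable (LAS) if it is stable and there is $\delta>0$ such that $y(t)\to y^*$ as $t\to\infty$ for all solutions on $[0,\infty)$ with $\|y(0)-y^*\|<\delta$. For a discrete system $y_{k+1}=g(y_k)$, a fixed point $y^*$ is stable if for every $\varepsilon>0$ there is $\delta>0$ such that $\|y_0-y^*\|<\delta$ implies $\|y_k-y^*\|<\varepsilon$ for all $k\ge 0$; unstable if it is not stable; and LAS if it is stable and there is $\eta>0$ such that $\|y_0-y^*\|<\eta$ implies $y_k\to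 y^*$ as $k\to\infty$. Let $\mathcal F$ be the union of the sets of eigenvalues of $J(y^*)$ over all LAS equilibria $y^*$ of $y'=f(y)$, and let $$m_S=\max_{\lambda\in\mathcal F}\left\{-\frac{|\lambda|^2}{2\,\mathrm{Re}\,\lambda}\right\},$$ with the convention $m_S=0$ if $\mathcal F=\emptyset$. Let $\varphi$ be a denominator function: $\varphi(\Delta t)>0$ for all $\Delta t>0$, and $\varphi(\Delta t)=\Delta t+\mathcal O(\Delta t^2)$ as $\Delta t\to 0^+$. If $m\in\mathbb{R}$ satisfies $m\ge m_S$, then for every step size $\Delta t>0$ the scheme $$y_{k+1}=y_k+\frac{\varphi(\Delta t)}{1+m\varphi(\Delta t)}\,f(y_k)$$ preserves the local asymptotic stability of $y'=f(y)$: every equilibrium $y^*$ of $y'=f(y)$ is a fixed point of the scheme; if $y^*$ is stable for $y'=f(y)$ (in particular, if it is LAS), then it is LAS for the scheme; and if $y^*$ is unstable for $y'=f(y)$, then it is unstable for the scheme. -/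

import Mathlib

namespace NSFD

/-- `ℝⁿ` with the Euclidean norm. -/
abbrev Space (n : ℕ) : Type := EuclideanSpace ℝ (Fin n)

section Continuous

variable {n : ℕ}

/-- `y` is a solution on `[0, ∞)` of the initial value problem `y' = f(y)`, `y(0) = y₀`
(at `t = 0` the derivative is the right derivative). -/
def IsSolution (f : Space n → Space n) (y₀ : Space n) (y : ℝ → Space n) : Prop :=
  y 0 = y₀ ∧ IsIntegralCurveOn y (fun _ => f) (Set.Ici 0)

/-- The set of equilibrium points of `y' = f(y)`. -/
def equilibria (f : Space n → Space n) : Set (Space n) := {p | f p = 0}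

/-- `p` is a stable point of `y' = f(y)`: for each `ε > 0` there is `δ > 0` such that every solution
which starts `δ`-close to `p` stays `ε`-close to `p` for all `t ≥ 0`.
The solution is required to exist on `[0, ∞)`, so that an equilibrium which nearby
solutions leave by a blow-up in finite time is not vacuously stable. -/
def IsStableODE (f : Space n → Space n) (p : Space n) : Prop :=
  ∀ ε > 0, ∃ δ > 0, ∀ y₀ : Space n, ‖y₀ - p‖ < δ →
    (∃ y, IsSolution f y₀ y) ∧
      ∀ y, IsSolution f y₀ y → ∀ t : ℝ, 0 ≤ t → ‖y t - p‖ < ε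

/-- `p` is (locally) asymptotically stable for `y' = f(y)`: it is stable, and the solutions which
start close enough to `p` tend to `p` as `t → ∞`. -/
def IsLASODE (f : Space n → Space n) (p : Space n) : Prop :=
  IsStableODE f p ∧
    ∃ δ > 0, ∀ y₀ : Space n, ‖y₀ - p‖ < δ →
      ∀ y, IsSolution f y₀ y → Filter.Tendsto y Filter.atTop (nhds p)

/-- The Jacobian matrix `(∂ f_i / ∂ y_j)(p)`. -/
noncomputable def jacobian (f : Space n → Space n) (p : Space n) : Matrix (Fin n) (Fin n) ℝ :=
  Matrix.of fun i j => (fderiv ℝ f p (EuclideanSpace.single j 1)) i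

/-- The set of complex eigenvalues of the Jacobian matrix of `f` at `p`. -/
noncomputable def jacobianEigenvalues (f : Space n → Space n) (p : Space n) : Set ℂ :=
  spectrum ℂ ((jacobian f p).map (algebraMap ℝ ℂ))

/-- No eigenvalue of the Jacobian matrix at `p` lies on the imaginary axis. -/
def IsHyperbolic (f : Space n → Space n) (p : Space n) : Prop :=
  ∀ l ∈ jacobianEigenvalues f p, l.re ≠ 0

/-- The union, over the asymptotically stable equilibria of `y' = f(y)`, of the sets of
eigenvalues of the Jacobian matrices. -/
def stableEigenvalues (f : Space n → Space n) : Set ℂ :=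
  ⋃ p ∈ {p | p ∈ equilibria f ∧ IsLASODE f p}, jacobianEigenvalues f p

/-- The set of the numbers `-|λ|² / (2 Re λ)`, for `λ` in `stableEigenvalues f`. -/
noncomputable def thresholdValues (f : Space n → Space n) : Set ℝ :=
  (fun l : ℂ => -‖l‖ ^ 2 / (2 * l.re)) '' stableEigenvalues f

/-- The stability threshold `m_S`, the maximum of `-|λ|² / (2 Re λ)` over the eigenvalues `λ` at
asymptotically stable equilibria (see `isGreatest_stabilityThreshold`); it is `0` when there is
no such eigenvalue (see `stabilityThreshold_of_isEmpty`). -/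
noncomputable def stabilityThreshold (f : Space n → Space n) : ℝ :=
  sSup (thresholdValues f)

theorem finite_jacobianEigenvalues (f : Space n → Space n) (p : Space n) :
    (jacobianEigenvalues f p).Finite :=
  Matrix.finite_spectrum _

/-- With finitely many equilibria the threshold is a true maximum. -/
theorem isGreatest_stabilityThreshold (f : Space n → Space n) (hfin : (equilibria f).Finite)
    (hne : (stableEigenvalues f).Nonempty) :
    IsGreatest (thresholdValues f) (stabilityThreshold f) := by
  have h : (stableEigenvalues f).Finite :=
    Set.Finite.biUnion (hfin.subset fun _ hp => hp.1) fun p _ => finite_jacobianEigenvalues f p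
  exact ⟨(hne.image _).csSup_mem (h.image _), fun x hx => le_csSup (h.image _).bddAbove hx⟩

theorem stabilityThreshold_of_isEmpty (f : Space n → Space n) (h : stableEigenvalues f = ∅) :
    stabilityThreshold f = 0 := by
  simp [stabilityThreshold, thresholdValues, h]

end Continuous

section Discrete

variable {n : ℕ}

/-- `p` is a stable point of `y_{k+1} = g(y_k)`. -/
def IsStableMap (g : Space n → Space n) (p : Space n) : Prop :=
  ∀ ε > 0, ∃ δ > 0, ∀ y₀ : Space n, ‖y₀ - p‖ < δ → ∀ k : ℕ, ‖g^[k] y₀ - p‖ < ε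

/-- `p` is attracting for `y_{k+1} = g(y_k)`. -/
def IsAttractingMap (g : Space n → Space n) (p : Space n) : Prop :=
  ∃ η > 0, ∀ y₀ : Space n, ‖y₀ - p‖ < η →
    Filter.Tendsto (fun k : ℕ => g^[k] y₀) Filter.atTop (nhds p)

/-- `p` is (locally) asymptotically stable for `y_{k+1} = g(y_k)`. -/
def IsLASMap (g : Space n → Space n) (p : Space n) : Prop :=
  IsStableMap g p ∧ IsAttractingMap g p

/-- A nonstandard denominator function: `φ(Δt) > 0` for every step size `Δt > 0`, and
`φ(Δt) = Δt + O(Δt²)` as `Δt → 0⁺`. -/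
structure IsDenominatorFunction (φ : ℝ → ℝ) : Prop where
  pos : ∀ h : ℝ, 0 < h → 0 < φ h
  expansion : (fun h : ℝ => φ h - h) =O[nhdsWithin 0 (Set.Ioi 0)] fun h : ℝ => h ^ 2

/-- One step `y ↦ y + φ / (1 + m φ) f(y)` of the scheme, `c` being the value `φ(Δt)`. -/
noncomputable def scheme (f : Space n → Space n) (m c : ℝ) (y : Space n) : Space n :=
  y + (c / (1 + m * c)) • f y

/-- The scheme is the solved form of
`(y_{k+1} - y_k) / φ = f(y_k) + m y_k - m y_{k+1}`. -/
theorem eq_scheme_iff (f : Space n → Space n) (m c : ℝ) (hc : c ≠ 0) (hmc : 1 + m * c ≠ 0)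
    (y z : Space n) :
    z = scheme f m c y ↔ c⁻¹ • (z - y) = f y + m • y - m • z := by
  have key : ∀ i, z i = y i + c / (1 + m * c) * f y i ↔
      c⁻¹ * (z i - y i) = f y i + m * y i - m * z i := by
    intro i
    have hmc' : 1 + c * m ≠ 0 := by rwa [mul_comm c m]
    field_simp
    constructor <;> intro h <;> linarith
  constructor
  · intro h
    ext i
    have := (key i).1 (by rw [h]; simp [scheme])
    simpa using this
  · intro h
    ext i
    have := (key i).2 (by simpa using congrArg (fun v : Space n => v i) h)
    simpa [scheme] using this

end Discrete

end NSFD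

/-! ### Near-diagonalization of complex endomorphisms -/

namespace NSFD

open Module

/-! At an equilibrium with Jacobian `J`, the scheme has derivative `1 + s J` with `s = φ / (1 + m
φ)`, and `|1 + s λ|² = 1 + s (2 Re λ + s |λ|²)`. If `Re λ > 0`, this exceeds 1 for every `s > 0`. If
`Re λ < 0` and `-|λ|² / (2 Re λ) ≤ m`, then `s |λ|² ≤ s m (-2 Re λ) < -2 Re λ`, because `s m < 1`;
so the modulus is below 1 whatever the step size. At a hyperbolic equilibrium, stability forces `Re
λ < 0` for all `λ`, which gives LAS; the eigenvalues concerned are thus exactly those counted in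
`m_S`.

What remains is linearization, for the flow and for the map. Both rest on one quadratic form `B`: in
nearly diagonal coordinates, a signed sum of squares that grows under the linear dynamics
(`exists_form_flow`, `exists_form_iterate`). If every eigenvalue is stable, `B` is negative definite
and `-B` is a Lyapunov function. If some eigenvalue is unstable, `B` is positive somewhere, and
orbits starting there must leave a fixed ball. -/

/-- Every endomorphism of a finite-dimensional complex space is, in suitable coordinates, an
arbitrarily small perturbation of a diagonal one. -/
theorem exists_nearly_diagonal (N : ℕ) : ∀ (V : Type) [AddCommGroup V] [Module ℂ V]
    [FiniteDimensional ℂ V] (T : End ℂ V), finrank ℂ V = N → ∀ ε > (0 : ℝ),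
    ∃ (d : Fin N → ℂ) (L : V →ₗ[ℂ] (Fin N → ℂ)), (∀ i, T.HasEigenvalue (d i)) ∧
      Function.Injective L ∧ ∀ v i, ‖L (T v) i - d i * L v i‖ ≤ ε * ‖L v‖ := by
  induction N with
  | zero =>
    intro V _ _ _ T hV ε hε
    have := finrank_zero_iff.1 hV
    exact ⟨0, 0, fun i => i.elim0, fun x y _ => Subsingleton.elim x y, fun v i => i.elim0⟩
  | succ N ih =>
    intro V _ _ _ T hV ε hε
    have : Nontrivial V := Module.nontrivial_of_finrank_pos (R := ℂ) (by omega)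
    obtain ⟨c, hc⟩ := End.exists_eigenvalue T
    -- `T - c` is not injective, hence not onto. A nonzero functional `l` killing its range is a
    -- left eigenvector, so `ker l` is an invariant hyperplane for the induction.
    have hlt : LinearMap.range (T - algebraMap ℂ (End ℂ V) c) < ⊤ := by
      rw [lt_top_iff_ne_top, Ne, LinearMap.range_eq_top, ← LinearMap.injective_iff_surjective,
        ← LinearMap.ker_eq_bot]
      rw [End.hasEigenvalue_iff, End.eigenspace_def] at hc
      exact hc
    obtain ⟨l, hl, hle⟩ := Submodule.exists_le_ker_of_lt_top _ hlt
    have hlT : ∀ v, l (T v) = c * l v := by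
      intro v
      have h := hle (LinearMap.mem_range_self (T - algebraMap ℂ (End ℂ V) c) v)
      rw [LinearMap.mem_ker] at h
      simpa [Algebra.algebraMap_eq_smul_one, sub_eq_zero] using h
    obtain ⟨u₀, hu₀⟩ : ∃ u, l u ≠ 0 := by
      by_contra! h
      exact hl (LinearMap.ext h)
    set u : V := (l u₀)⁻¹ • u₀ with hu
    have hlu : l u = 1 := by simp [hu, hu₀]
    have hW : ∀ x ∈ LinearMap.ker l, T x ∈ LinearMap.ker l := by
      intro x hx
      rw [LinearMap.mem_ker] at hx ⊢
      rw [hlT, hx, mul_zero]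
    have hdim : finrank ℂ (LinearMap.ker l) = N := by
      have := Module.Dual.finrank_ker_add_one_of_ne_zero (f := l) hl
      omega
    obtain ⟨d, M, hd, hM, hMT⟩ := ih (LinearMap.ker l) (T.restrict hW) hdim (ε / 2) (by positivity)
    let proj : V →ₗ[ℂ] LinearMap.ker l :=
      LinearMap.codRestrict (LinearMap.ker l) (LinearMap.id - l.smulRight u) (by
        intro x
        simp [hlu])
    have hproj : ∀ v, (proj v : V) = v - l v • u := fun v => rfl
    set w := proj (T u) with hw
    have hTp : ∀ v, proj (T v) = T.restrict hW (proj v) + l v • w := by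
      intro v
      apply Subtype.ext
      simp only [Submodule.coe_add, Submodule.coe_smul, hproj, hw, LinearMap.restrict_apply, hlT,
        map_sub, map_smul, hlu]
      module
    -- `w` couples the new coordinate to the old ones. Weighting `l` by a large `K` makes this
    -- coupling cost only `ε / 2`; the `+ 1` keeps `K` positive when `M w = 0`.
    set K : ℝ := 2 * ‖M w‖ / ε + 1 with hK
    have hKpos : 0 < K := by positivity
    have hKw : ‖M w‖ ≤ ε / 2 * K := by
      rw [hK]; field_simp; linarith
    refine ⟨Fin.cons c d, LinearMap.pi (Fin.cons ((K : ℂ) • l)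
      (fun i => (LinearMap.proj i).comp (M.comp proj))), ?_, ?_, ?_⟩
    · intro i
      refine Fin.cases hc (fun i => ?_) i
      obtain ⟨x, hx⟩ := (hd i).exists_hasEigenvector
      refine End.hasEigenvalue_of_hasEigenvector (x := (x : V)) ⟨?_, by simpa using hx.2⟩
      rw [End.mem_eigenspace_iff]
      have := hx.apply_eq_smul
      simpa using congrArg Subtype.val this
    · rw [← LinearMap.ker_eq_bot, LinearMap.ker_eq_bot']
      intro v hv
      have h0 : l v = 0 := by
        have := congrFun hv 0
        simpa [hKpos.ne'] using this
      have h1 : M (proj v) = 0 := by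
        ext i
        simpa using congrFun hv i.succ
      have h2 : proj v = 0 := hM (by simpa using h1)
      have h3 := hproj v
      rw [h2, h0] at h3
      simpa using h3.symm
    · intro v i
      set Z := (LinearMap.pi (Fin.cons ((K : ℂ) • l)
        (fun i => (LinearMap.proj i).comp (M.comp proj))) : V →ₗ[ℂ] (Fin (N + 1) → ℂ)) v with hZ
      have hZ0 : K * ‖l v‖ ≤ ‖Z‖ := by
        have := norm_le_pi_norm Z 0
        simpa [hZ, abs_of_pos hKpos] using this
      have hZs : ‖M (proj v)‖ ≤ ‖Z‖ := by
        rw [pi_norm_le_iff_of_nonneg (norm_nonneg _)]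
        intro i
        have := norm_le_pi_norm Z i.succ
        simpa [hZ] using this
      refine Fin.cases ?_ (fun i => ?_) i
      · have : (0 : ℝ) ≤ ε * ‖Z‖ := by positivity
        simp only [hZ, LinearMap.pi_apply, Fin.cons_zero, LinearMap.smul_apply, hlT, smul_eq_mul]
        rw [show (K : ℂ) * (c * l v) - c * (K * l v) = 0 by ring, norm_zero]
        exact this
      · simp only [hZ, LinearMap.pi_apply, Fin.cons_succ, LinearMap.comp_apply,
          LinearMap.proj_apply, hTp, map_add, map_smul, smul_eq_mul]
        rw [add_sub_right_comm]
        calc _ ≤ ε / 2 * ‖M (proj v)‖ + ‖l v‖ * ‖M w‖ := by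
              refine (norm_add_le _ _).trans (add_le_add (hMT _ i) ?_)
              rw [norm_mul]
              gcongr
              exact norm_le_pi_norm (M w) i
          _ ≤ ε / 2 * ‖Z‖ + ‖l v‖ * (ε / 2 * K) := by gcongr
          _ = ε / 2 * ‖Z‖ + ε / 2 * (K * ‖l v‖) := by ring
          _ ≤ ε / 2 * ‖Z‖ + ε / 2 * ‖Z‖ := by gcongr
          _ = ε * ‖Z‖ := by ring

end NSFD

/-! ### Quadratic forms adapted to a real operator -/

namespace NSFD

open Module Matrix

/-- The inclusion of `ℝⁿ` into `ℂⁿ`. -/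
noncomputable def complexify {n : ℕ} : Space n →ₗ[ℝ] (Fin n → ℂ) where
  toFun x := fun i => (x i : ℂ)
  map_add' x y := by ext i; simp
  map_smul' c x := by ext i; simp

@[simp] theorem complexify_apply {n : ℕ} (x : Space n) (i : Fin n) :
    complexify x i = (x i : ℂ) := rfl

theorem complexify_injective {n : ℕ} :
    Function.Injective (complexify : Space n → Fin n → ℂ) := by
  intro x y h
  ext i
  simpa using congrFun h i

/-- The complex matrix `M` acts on `ℝⁿ` as the real operator `A`. -/
def Represents {n : ℕ} (M : Matrix (Fin n) (Fin n) ℂ) (A : Space n →L[ℝ] Space n) : Prop :=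
  ∀ x, complexify (A x) = M *ᵥ complexify x

theorem exists_pos_le_of_finite {s : Set ℂ} (hs : s.Finite) (g : ℂ → ℝ) (hg : ∀ l ∈ s, 0 < g l) :
    ∃ a > 0, ∀ l ∈ s, a ≤ g l := by
  rcases s.eq_empty_or_nonempty with rfl | hne
  · exact ⟨1, one_pos, by simp⟩
  · obtain ⟨l, hl, h⟩ := Set.exists_min_image s g hs hne
    exact ⟨g l, hg l hl, h⟩

/-- The `n` complex coordinates are redundant on `ℝⁿ`, but only injectivity matters: it bounds their
sum of squares below. The error bound passes from the sup norm to the larger Euclidean one. -/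
theorem exists_nearly_diagonal_coordinates {n : ℕ} {M : Matrix (Fin n) (Fin n) ℂ}
    {A : Space n →L[ℝ] Space n} (hA : Represents M A) {ε : ℝ} (hε : 0 < ε) :
    ∃ (d : Fin n → ℂ) (l : Fin n → Space n →L[ℝ] ℂ), (∀ i, d i ∈ spectrum ℂ M) ∧
      (∃ c > 0, ∀ x, c * ‖x‖ ^ 2 ≤ ∑ i, ‖l i x‖ ^ 2) ∧
      ∀ x i, ‖l i (A x) - d i * l i x‖ ≤ ε * √(∑ i, ‖l i x‖ ^ 2) := by
  obtain ⟨d, L, hd, hL, hLT⟩ := exists_nearly_diagonal n (Fin n → ℂ) (Matrix.toLin' M)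
    (by simp) ε hε
  have hsup : ∀ z : Fin n → ℂ, ‖z‖ ≤ √(∑ i, ‖z i‖ ^ 2) := by
    intro z
    rw [pi_norm_le_iff_of_nonneg (Real.sqrt_nonneg _)]
    intro i
    apply Real.le_sqrt_of_sq_le
    exact Finset.single_le_sum (f := fun i => ‖z i‖ ^ 2) (fun _ _ => sq_nonneg _)
      (Finset.mem_univ i)
  let L' : Space n →ₗ[ℝ] (Fin n → ℂ) := (L.restrictScalars ℝ).comp complexify
  have hL' : Function.Injective L' := hL.comp complexify_injective
  obtain ⟨K, hK, hKL⟩ := L'.exists_antilipschitzWith (LinearMap.ker_eq_bot.2 hL')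
  have hKpos : (0 : ℝ) < K := hK
  refine ⟨d, fun i => LinearMap.toContinuousLinearMap ((LinearMap.proj (R := ℝ) i).comp L'), ?_,
    ⟨1 / (K : ℝ) ^ 2, by positivity, ?_⟩, ?_⟩
  · intro i
    have := (hd i).mem_spectrum
    rwa [Matrix.spectrum_toLin'] at this
  · intro x
    have h1 : ‖x‖ ≤ K * ‖L' x‖ := by
      simpa using hKL.le_mul_dist x 0
    have h2 : ‖x‖ ^ 2 ≤ (K : ℝ) ^ 2 * ∑ i, ‖L' x i‖ ^ 2 := by
      calc ‖x‖ ^ 2 ≤ (K * √(∑ i, ‖L' x i‖ ^ 2)) ^ 2 := by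
            gcongr
            exact h1.trans (by gcongr; exact hsup _)
        _ = _ := by
            rw [mul_pow, Real.sq_sqrt (Finset.sum_nonneg fun _ _ => sq_nonneg _)]
    rw [div_mul_eq_mul_div, one_mul, div_le_iff₀ (by positivity), mul_comm]
    exact h2
  · intro x i
    have h := hLT (complexify x) i
    rw [Matrix.toLin'_apply, ← hA x] at h
    exact h.trans (by gcongr; exact hsup _)

/-- The form `∑ i, σ i * Re (conj (l i x) * l i y)`. -/
noncomputable def diagonalForm {n : ℕ} (σ : Fin n → ℝ) (l : Fin n → Space n →L[ℝ] ℂ) :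
    Space n →L[ℝ] Space n →L[ℝ] ℝ :=
  ∑ i, σ i • (innerSL ℝ).bilinearComp (l i) (l i)

theorem diagonalForm_apply {n : ℕ} (σ : Fin n → ℝ) (l : Fin n → Space n →L[ℝ] ℂ)
    (x y : Space n) : diagonalForm σ l x y = ∑ i, σ i * inner ℝ (l i x) (l i y) := by
  simp [diagonalForm]

theorem diagonalForm_symm {n : ℕ} (σ : Fin n → ℝ) (l : Fin n → Space n →L[ℝ] ℂ)
    (x y : Space n) : diagonalForm σ l x y = diagonalForm σ l y x := by
  simp only [diagonalForm_apply]
  exact Finset.sum_congr rfl fun i _ => by rw [real_inner_comm]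

theorem diagonalForm_self {n : ℕ} (σ : Fin n → ℝ) (l : Fin n → Space n →L[ℝ] ℂ)
    (x : Space n) : diagonalForm σ l x x = ∑ i, σ i * ‖l i x‖ ^ 2 := by
  simp only [diagonalForm_apply, real_inner_self_eq_norm_sq]

theorem inner_mul_self (d z : ℂ) : inner ℝ z (d * z) = d.re * ‖z‖ ^ 2 := by
  rw [Complex.inner, ← Complex.normSq_eq_norm_sq, Complex.normSq_apply]
  simp
  ring

/-- The `n` errors together cost at most half of the gain `a * q`. The factor `n + 1` allows a
choice of `δ` by division even when `n = 0`. -/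
theorem sum_sub_error_ge {n : ℕ} {a δ q : ℝ} {u v : Fin n → ℝ} (hq : q = ∑ i, v i) (hq0 : 0 ≤ q)
    (hδ : (n + 1) * δ ≤ a / 2) (hδ0 : 0 ≤ δ) (h : ∀ i, a * v i - δ * q ≤ u i) :
    a / 2 * q ≤ ∑ i, u i := by
  calc a / 2 * q ≤ a * q - n * (δ * q) := by nlinarith [mul_nonneg hδ0 hq0]
    _ = ∑ i, (a * v i - δ * q) := by
        rw [Finset.sum_sub_distrib, ← Finset.mul_sum, ← hq]; simp
    _ ≤ _ := Finset.sum_le_sum fun i _ => h i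

/-- A quadratic form which grows along the linear flow of a hyperbolic operator. -/
theorem exists_form_flow {n : ℕ} {M : Matrix (Fin n) (Fin n) ℂ} {A : Space n →L[ℝ] Space n}
    (hA : Represents M A) (hM : ∀ l ∈ spectrum ℂ M, l.re ≠ 0) :
    ∃ B : Space n →L[ℝ] Space n →L[ℝ] ℝ, (∀ x y, B x y = B y x) ∧
      (∃ η > 0, ∀ x, η * ‖x‖ ^ 2 ≤ B x (A x)) ∧
      ((∀ l ∈ spectrum ℂ M, l.re < 0) → ∃ c > 0, ∀ x, B x x ≤ -(c * ‖x‖ ^ 2)) := by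
  obtain ⟨a, ha, haM⟩ := exists_pos_le_of_finite (Matrix.finite_spectrum M) (fun l => |l.re|)
    fun l hl => abs_pos.2 (hM l hl)
  obtain ⟨d, l, hd, ⟨c, hc, hcl⟩, hdl⟩ := exists_nearly_diagonal_coordinates hA
    (show 0 < a / 2 / (n + 1) by positivity)
  set ε := a / 2 / (n + 1) with hε
  have hε0 : 0 < ε := by positivity
  -- With this sign, each diagonal term contributes `|Re (d i)| * ‖l i x‖ ^ 2`, at least `a * ‖l i
  -- x‖ ^ 2`.
  let σ : Fin n → ℝ := fun i => SignType.sign (d i).re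
  refine ⟨diagonalForm σ l, diagonalForm_symm σ l, ⟨a / 2 * c, by positivity, fun x => ?_⟩,
    fun hneg => ⟨c, hc, fun x => ?_⟩⟩
  · set q := ∑ i, ‖l i x‖ ^ 2 with hq
    have hq0 : 0 ≤ q := Finset.sum_nonneg fun _ _ => sq_nonneg _
    have hzq : ∀ i, ‖l i x‖ ≤ √q := fun i => Real.le_sqrt_of_sq_le
      (Finset.single_le_sum (f := fun i => ‖l i x‖ ^ 2) (fun _ _ => sq_nonneg _)
        (Finset.mem_univ i))
    calc a / 2 * c * ‖x‖ ^ 2 = a / 2 * (c * ‖x‖ ^ 2) := by ring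
      _ ≤ a / 2 * q := by gcongr; exact hcl x
      _ ≤ _ := ?_
    rw [diagonalForm_apply]
    refine sum_sub_error_ge hq hq0 (δ := ε) (by rw [hε]; field_simp; rfl) hε0.le fun i => ?_
    have hsplit : l i (A x) = d i * l i x + (l i (A x) - d i * l i x) := by ring
    set e := l i (A x) - d i * l i x with he
    have h1 : |inner ℝ (l i x) e| ≤ ε * q := by
      refine (abs_real_inner_le_norm _ _).trans ?_
      calc _ ≤ √q * (ε * √q) := mul_le_mul (hzq i) (hdl x i) (norm_nonneg _) (Real.sqrt_nonneg _)
        _ = ε * (√q * √q) := by ring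
        _ = ε * q := by rw [Real.mul_self_sqrt hq0]
    have h2 : |σ i * inner ℝ (l i x) e| ≤ ε * q := by
      refine le_trans ?_ h1
      rw [abs_mul]
      have : |σ i| ≤ 1 := by
        simp only [σ]
        rcases lt_trichotomy (d i).re 0 with h | h | h <;> simp [h]
      exact mul_le_of_le_one_left (abs_nonneg _) this
    have h3 : a * ‖l i x‖ ^ 2 ≤ σ i * ((d i).re * ‖l i x‖ ^ 2) := by
      rw [← mul_assoc]
      simp only [σ, sign_mul_self]
      gcongr
      exact haM _ (hd i)
    rw [hsplit, inner_add_right, inner_mul_self, mul_add]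
    linarith [neg_le_of_abs_le h2]
  · rw [diagonalForm_self]
    have : ∀ i, σ i = -1 := fun i => by simp [σ, hneg _ (hd i)]
    simp only [this, neg_mul, one_mul, Finset.sum_neg_distrib]
    exact neg_le_neg (hcl x)

/-- A quadratic form which grows by more than the factor `r ^ 2` under an operator without
eigenvalues of modulus `r`. -/
theorem exists_form_iterate {n : ℕ} {M : Matrix (Fin n) (Fin n) ℂ} {A : Space n →L[ℝ] Space n}
    (hA : Represents M A) {r : ℝ} (hr : 0 < r) (hM : ∀ l ∈ spectrum ℂ M, ‖l‖ ≠ r) :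
    ∃ B : Space n →L[ℝ] Space n →L[ℝ] ℝ, (∀ x y, B x y = B y x) ∧
      (∃ η > 0, ∀ x, r ^ 2 * B x x + η * ‖x‖ ^ 2 ≤ B (A x) (A x)) ∧
      ((∀ l ∈ spectrum ℂ M, ‖l‖ < r) → ∃ c > 0, ∀ x, B x x ≤ -(c * ‖x‖ ^ 2)) := by
  obtain ⟨a, ha, haM⟩ := exists_pos_le_of_finite (Matrix.finite_spectrum M)
    (fun l => |‖l‖ ^ 2 - r ^ 2|) fun l hl => abs_pos.2 (sub_ne_zero.2 fun h => hM l hl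
      ((sq_eq_sq₀ (norm_nonneg _) hr.le).1 h))
  obtain ⟨R, hR⟩ := (Matrix.finite_spectrum M).isBounded.exists_norm_le
  -- In `‖d z + e‖²` the cross term costs `2 |R| ε q`, and `‖e‖²` costs at most `ε q` as `ε ≤ 1`.
  set R' := 2 * |R| + 1 with hR'
  have hR'0 : 0 < R' := by positivity
  obtain ⟨ε, hε0, hε1, hε⟩ : ∃ ε > 0, ε ≤ 1 ∧ (n + 1) * (R' * ε) ≤ a / 2 := by
    refine ⟨min 1 (a / 2 / ((n + 1) * R')), by positivity, min_le_left _ _, ?_⟩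
    calc _ ≤ (n + 1) * (R' * (a / 2 / ((n + 1) * R'))) := by gcongr; exact min_le_right _ _
      _ = a / 2 := by field_simp
  obtain ⟨d, l, hd, ⟨c, hc, hcl⟩, hdl⟩ := exists_nearly_diagonal_coordinates hA hε0
  let σ : Fin n → ℝ := fun i => SignType.sign (‖d i‖ ^ 2 - r ^ 2)
  refine ⟨diagonalForm σ l, diagonalForm_symm σ l, ⟨a / 2 * c, by positivity, fun x => ?_⟩,
    fun hlt => ⟨c, hc, fun x => ?_⟩⟩
  · set q := ∑ i, ‖l i x‖ ^ 2 with hq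
    have hq0 : 0 ≤ q := Finset.sum_nonneg fun _ _ => sq_nonneg _
    have hzq : ∀ i, ‖l i x‖ ≤ √q := fun i => Real.le_sqrt_of_sq_le
      (Finset.single_le_sum (f := fun i => ‖l i x‖ ^ 2) (fun _ _ => sq_nonneg _)
        (Finset.mem_univ i))
    have key : a / 2 * q ≤ ∑ i, (σ i * ‖l i (A x)‖ ^ 2 - r ^ 2 * (σ i * ‖l i x‖ ^ 2)) := by
      refine sum_sub_error_ge hq hq0 hε (by positivity) fun i => ?_
      have hsplit : l i (A x) = d i * l i x + (l i (A x) - d i * l i x) := by ring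
      have he1 := hdl x i
      set e := l i (A x) - d i * l i x with he
      have hdR : ‖d i‖ ≤ |R| := (hR _ (hd i)).trans (le_abs_self R)
      have h1 : |‖l i (A x)‖ ^ 2 - ‖d i‖ ^ 2 * ‖l i x‖ ^ 2| ≤ R' * ε * q := by
        rw [hsplit, norm_add_sq_real, norm_mul, mul_pow]
        have : |inner ℝ (d i * l i x) e| ≤ |R| * √q * (ε * √q) := by
          refine (abs_real_inner_le_norm _ _).trans ?_
          rw [norm_mul]
          gcongr
          exact hzq i
        have h2 : ‖e‖ ^ 2 ≤ ε * q := by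
          calc ‖e‖ ^ 2 ≤ (ε * √q) ^ 2 := by gcongr
            _ = ε * (ε * q) := by rw [mul_pow, Real.sq_sqrt hq0]; ring
            _ ≤ ε * (1 * q) := by gcongr
            _ = ε * q := by ring
        have h3 : |R| * √q * (ε * √q) = |R| * ε * q := by
          rw [show |R| * √q * (ε * √q) = |R| * ε * (√q * √q) by ring, Real.mul_self_sqrt hq0]
        rw [h3] at this
        rw [abs_le] at this ⊢
        rw [hR']
        constructor <;> nlinarith [sq_nonneg ‖e‖]
      have h2 : |σ i * (‖l i (A x)‖ ^ 2 - ‖d i‖ ^ 2 * ‖l i x‖ ^ 2)| ≤ R' * ε * q := by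
        refine le_trans ?_ h1
        rw [abs_mul]
        have : |σ i| ≤ 1 := by
          simp only [σ]
          rcases lt_trichotomy (‖d i‖ ^ 2 - r ^ 2) 0 with h | h | h <;> simp [h]
        exact mul_le_of_le_one_left (abs_nonneg _) this
      have h3 : a * ‖l i x‖ ^ 2 ≤ σ i * (‖d i‖ ^ 2 - r ^ 2) * ‖l i x‖ ^ 2 := by
        simp only [σ, sign_mul_self]
        gcongr
        exact haM _ (hd i)
      linarith [neg_le_of_abs_le h2]
    rw [Finset.sum_sub_distrib, ← Finset.mul_sum, ← diagonalForm_self, ← diagonalForm_self] at key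
    have : a / 2 * c * ‖x‖ ^ 2 ≤ a / 2 * q := by
      rw [mul_assoc]; gcongr; exact hcl x
    linarith
  · rw [diagonalForm_self]
    have : ∀ i, σ i = -1 := fun i => by
      have : ‖d i‖ ^ 2 - r ^ 2 < 0 := sub_neg.2 (by gcongr; exact hlt _ (hd i))
      simp [σ, this]
    simp only [this, neg_mul, one_mul, Finset.sum_neg_distrib]
    exact neg_le_neg (hcl x)

theorem exists_real_imag_parts {n : ℕ} {M : Matrix (Fin n) (Fin n) ℂ} {A : Space n →L[ℝ] Space n}
    (hA : Represents M A) {l : ℂ} (hl : l ∈ spectrum ℂ M) :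
    ∃ a b : Space n, (a ≠ 0 ∨ b ≠ 0) ∧ A a = l.re • a - l.im • b ∧ A b = l.im • a + l.re • b := by
  rw [← Matrix.spectrum_toLin'] at hl
  obtain ⟨w, hw⟩ := (End.HasEigenvalue.of_mem_spectrum hl).exists_hasEigenvector
  have hw1 : M *ᵥ w = l • w := by simpa using hw.apply_eq_smul
  let a : Space n := WithLp.toLp 2 fun i => (w i).re
  let b : Space n := WithLp.toLp 2 fun i => (w i).im
  have hab : w = complexify a + Complex.I • complexify b := by
    ext i
    simp only [Pi.add_apply, complexify_apply, Pi.smul_apply, smul_eq_mul, a, b]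
    rw [mul_comm]
    exact (Complex.re_add_im (w i)).symm
  have key : complexify (A a) + Complex.I • complexify (A b) = l • w := by
    rw [hA, hA, ← hw1, hab, Matrix.mulVec_add, Matrix.mulVec_smul]
  have hi : ∀ i, ((A a i : ℝ) : ℂ) + Complex.I * (A b i : ℝ) = l * w i := fun i => by
    simpa using congrFun key i
  refine ⟨a, b, ?_, ?_, ?_⟩
  · by_contra! h
    exact hw.2 (by rw [hab, h.1, h.2]; simp)
  · ext i
    simpa [a, b] using congrArg Complex.re (hi i)
  · ext i
    have := congrArg Complex.im (hi i)
    simp at this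
    simp [a, b]
    linarith

theorem norm_sq_add_norm_sq_pos {n : ℕ} {a b : Space n} (hab : a ≠ 0 ∨ b ≠ 0) :
    0 < ‖a‖ ^ 2 + ‖b‖ ^ 2 := by
  rcases hab with h | h
  · have := norm_pos_iff.2 h; positivity
  · have := norm_pos_iff.2 h; positivity

/-- For an eigenvector `a + i b`, adding `B a (A a)` and `B b (A b)` cancels the cross terms by
symmetry and leaves `Re l * (B a a + B b b)`, which must be positive. -/
theorem exists_pos_of_flow {n : ℕ} {M : Matrix (Fin n) (Fin n) ℂ} {A : Space n →L[ℝ] Space n}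
    (hA : Represents M A) {B : Space n →L[ℝ] Space n →L[ℝ] ℝ} (hB : ∀ x y, B x y = B y x)
    {η : ℝ} (hη : 0 < η) (hBA : ∀ x, η * ‖x‖ ^ 2 ≤ B x (A x))
    {l : ℂ} (hl : l ∈ spectrum ℂ M) (hre : 0 < l.re) : ∃ x, 0 < B x x := by
  obtain ⟨a, b, hab, ha, hb⟩ := exists_real_imag_parts hA hl
  by_contra! h
  have h1 := hBA a
  have h2 := hBA b
  rw [ha] at h1
  rw [hb] at h2
  simp only [map_sub, map_add, map_smul, smul_eq_mul] at h1 h2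
  rw [hB b a] at h2
  have h3 := norm_sq_add_norm_sq_pos hab
  nlinarith [mul_nonneg hre.le (neg_nonneg.2 (h a)), mul_nonneg hre.le (neg_nonneg.2 (h b)),
    mul_pos hη h3]

/-- As for the flow: the cross terms cancel in `B (A a) (A a) + B (A b) (A b) = ‖l‖ ^ 2 * (B a a + B
b b)`. -/
theorem exists_pos_of_iterate {n : ℕ} {M : Matrix (Fin n) (Fin n) ℂ} {A : Space n →L[ℝ] Space n}
    (hA : Represents M A) {B : Space n →L[ℝ] Space n →L[ℝ] ℝ} (hB : ∀ x y, B x y = B y x)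
    {η r : ℝ} (hη : 0 < η) (hr : 0 < r) (hBA : ∀ x, r ^ 2 * B x x + η * ‖x‖ ^ 2 ≤ B (A x) (A x))
    {l : ℂ} (hl : l ∈ spectrum ℂ M) (hlr : r < ‖l‖) : ∃ x, 0 < B x x := by
  obtain ⟨a, b, hab, ha, hb⟩ := exists_real_imag_parts hA hl
  by_contra! h
  have h1 := hBA a
  have h2 := hBA b
  rw [ha] at h1
  rw [hb] at h2
  simp only [map_sub, map_add, map_smul, smul_eq_mul, FunLike.coe_sub, FunLike.coe_add,
    FunLike.coe_smul, Pi.sub_apply, Pi.add_apply, Pi.smul_apply] at h1 h2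
  rw [hB b a] at h1 h2
  have h3 := norm_sq_add_norm_sq_pos hab
  have h4 : r ^ 2 < l.re ^ 2 + l.im ^ 2 := by
    have : ‖l‖ ^ 2 = l.re ^ 2 + l.im ^ 2 := by
      rw [← Complex.normSq_eq_norm_sq, Complex.normSq_apply]; ring
    rw [← this]; gcongr
  nlinarith [mul_nonneg (sub_pos.2 h4).le (neg_nonneg.2 (h a)),
    mul_nonneg (sub_pos.2 h4).le (neg_nonneg.2 (h b)), mul_pos hη h3]

end NSFD

/-! ### From quadratic forms to nonlinear stability and instability -/

namespace NSFD

open Filter Topology Metric Set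

theorem abs_form_apply_le {n : ℕ} (B : Space n →L[ℝ] Space n →L[ℝ] ℝ) (x y : Space n) :
    |B x y| ≤ ‖B‖ * ‖x‖ * ‖y‖ := by
  simpa using B.le_opNorm₂ x y

theorem exists_remainder_le {n : ℕ} {f : Space n → Space n} {A : Space n →L[ℝ] Space n}
    {p : Space n} (hf : HasFDerivAt f A p) {c : ℝ} (hc : 0 < c) :
    ∃ ρ > 0, ∀ x, ‖x - p‖ < ρ → ‖f x - f p - A (x - p)‖ ≤ c * ‖x - p‖ := by
  have := hf.isLittleO.def hc
  obtain ⟨ρ, hρ, h⟩ := Metric.eventually_nhds_iff.1 this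
  exact ⟨ρ, hρ, fun x hx => h (by rwa [dist_eq_norm])⟩

theorem exists_flow_remainder_le {n : ℕ} {f : Space n → Space n} {A : Space n →L[ℝ] Space n}
    {p : Space n} (hf : HasFDerivAt f A p) (hp : f p = 0)
    (B : Space n →L[ℝ] Space n →L[ℝ] ℝ) {η : ℝ} (hη : 0 < η)
    (hB : ∀ x, η * ‖x‖ ^ 2 ≤ B x (A x)) :
    ∃ ρ > 0, ∀ x, ‖x - p‖ < ρ → η / 2 * ‖x - p‖ ^ 2 ≤ B (x - p) (f x) := by
  obtain ⟨ρ, hρ, h⟩ := exists_remainder_le hf (c := η / 2 / (‖B‖ + 1)) (by positivity)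
  refine ⟨ρ, hρ, fun x hx => ?_⟩
  have h1 := h x hx
  rw [hp, sub_zero] at h1
  set u := x - p
  set e := f x - A u with he
  have h2 : |B u e| ≤ η / 2 * ‖u‖ ^ 2 := by
    calc |B u e| ≤ ‖B‖ * ‖u‖ * ‖e‖ := abs_form_apply_le B u e
      _ ≤ (‖B‖ + 1) * ‖u‖ * (η / 2 / (‖B‖ + 1) * ‖u‖) := by gcongr; linarith
      _ = η / 2 * ‖u‖ ^ 2 := by field_simp
  have h3 : B u (f x) = B u (A u) + B u e := by rw [← map_add, he]; congr 1; abel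
  rw [h3]
  linarith [neg_le_of_abs_le h2, hB u]

theorem exists_iterate_remainder_le {n : ℕ} {g : Space n → Space n} {A : Space n →L[ℝ] Space n}
    {p : Space n} (hg : HasFDerivAt g A p) (hp : g p = p)
    (B : Space n →L[ℝ] Space n →L[ℝ] ℝ) {η r : ℝ} (hη : 0 < η)
    (hB : ∀ x, r ^ 2 * B x x + η * ‖x‖ ^ 2 ≤ B (A x) (A x)) :
    ∃ ρ > 0, ∀ x, ‖x - p‖ < ρ →
      r ^ 2 * B (x - p) (x - p) + η / 2 * ‖x - p‖ ^ 2 ≤ B (g x - p) (g x - p) := by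
  set D := (‖B‖ + 1) * (2 * ‖A‖ + 1) with hD
  have hD0 : 0 < D := by positivity
  obtain ⟨c, hc0, hc1, hcD⟩ : ∃ c > 0, c ≤ 1 ∧ D * c ≤ η / 2 := by
    refine ⟨min 1 (η / 2 / D), by positivity, min_le_left _ _, ?_⟩
    calc _ ≤ D * (η / 2 / D) := by gcongr; exact min_le_right _ _
      _ = η / 2 := by field_simp
  obtain ⟨ρ, hρ, h⟩ := exists_remainder_le hg hc0
  refine ⟨ρ, hρ, fun x hx => ?_⟩
  have h1 := h x hx
  rw [hp] at h1
  set u := x - p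
  set e := g x - p - A u with he
  have h3 : g x - p = A u + e := by rw [he]; abel
  have h4 : B (A u + e) (A u + e) = B (A u) (A u) + (B (A u) e + B e (A u) + B e e) := by
    simp only [map_add, FunLike.coe_add, Pi.add_apply]
    ring
  have hAu := A.le_opNorm u
  have h5 : |B (A u) e + B e (A u) + B e e| ≤ η / 2 * ‖u‖ ^ 2 := by
    calc _ ≤ |B (A u) e| + |B e (A u)| + |B e e| := abs_add_three _ _ _
      _ ≤ ‖B‖ * ‖A u‖ * ‖e‖ + ‖B‖ * ‖e‖ * ‖A u‖ + ‖B‖ * ‖e‖ * ‖e‖ := by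
          gcongr <;> exact abs_form_apply_le B _ _
      _ = ‖B‖ * ((2 * ‖A u‖ + ‖e‖) * ‖e‖) := by ring
      _ ≤ (‖B‖ + 1) * ((2 * (‖A‖ * ‖u‖) + 1 * ‖u‖) * (c * ‖u‖)) := by
          gcongr
          · linarith
          · exact h1.trans (by gcongr)
      _ = D * c * ‖u‖ ^ 2 := by rw [hD]; ring
      _ ≤ _ := by gcongr
  rw [h3, h4]
  linarith [neg_le_of_abs_le h5, hB u]

theorem hasDerivWithinAt_form {n : ℕ} (B : Space n →L[ℝ] Space n →L[ℝ] ℝ)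
    (hB : ∀ x y, B x y = B y x) {F : Space n → Space n} {y : ℝ → Space n} {y₀ p : Space n}
    (hy : IsSolution F y₀ y) {t : ℝ} (ht : 0 ≤ t) :
    HasDerivWithinAt (fun t => B (y t - p) (y t - p)) (2 * B (y t - p) (F (y t))) (Ici 0) t := by
  have h1 : HasDerivWithinAt (fun t => y t - p) (F (y t)) (Ici 0) t :=
    (hy.2 t ht).sub_const p
  have h2 : HasDerivWithinAt (fun t => B (y t - p)) (B (F (y t))) (Ici 0) t :=
    B.hasFDerivAt.comp_hasDerivWithinAt t h1
  have h3 := h2.clm_apply h1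
  refine h3.congr_deriv ?_
  rw [hB (F (y t))]
  ring

theorem exists_small_pos {n : ℕ} (B : Space n →L[ℝ] Space n →L[ℝ] ℝ) (h : ∃ x, 0 < B x x)
    {δ : ℝ} (hδ : 0 < δ) : ∃ x, ‖x‖ < δ ∧ 0 < B x x := by
  obtain ⟨x, hx⟩ := h
  refine ⟨(δ / (‖x‖ + 1)) • x, ?_, ?_⟩
  · rw [norm_smul, Real.norm_of_nonneg (by positivity), div_mul_eq_mul_div,
      div_lt_iff₀ (by positivity)]
    nlinarith [norm_nonneg x]
  · simp only [map_smul, FunLike.coe_smul, Pi.smul_apply, smul_eq_mul]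
    positivity

/-- Start with `B > 0`. While the solution stays in the ball, `B` does not decrease, which keeps it
away from `p`; hence `B` grows at least linearly, yet it is bounded on the ball. -/
theorem not_isStableODE_of_form {n : ℕ} {f : Space n → Space n} {p : Space n}
    {B : Space n →L[ℝ] Space n →L[ℝ] ℝ} (hB : ∀ x y, B x y = B y x) (hpos : ∃ x, 0 < B x x)
    {η ρ : ℝ} (hη : 0 < η) (hρ : 0 < ρ)
    (h : ∀ x, ‖x - p‖ < ρ → η * ‖x - p‖ ^ 2 ≤ B (x - p) (f x)) : ¬ IsStableODE f p := by
  intro hst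
  obtain ⟨δ, hδ, hst⟩ := hst ρ hρ
  obtain ⟨x, hxδ, hx⟩ := exists_small_pos B hpos hδ
  obtain ⟨⟨y, hy⟩, hall⟩ := hst (p + x) (by simpa using hxδ)
  have hstay := hall y hy
  set v : ℝ → ℝ := fun t => B (y t - p) (y t - p) with hv
  set b := ‖B‖ + 1 with hb
  have hb0 : 0 < b := by positivity
  have hvb : ∀ t, v t ≤ b * ‖y t - p‖ ^ 2 := fun t => by
    calc v t ≤ ‖B‖ * ‖y t - p‖ * ‖y t - p‖ := (le_abs_self _).trans (abs_form_apply_le B _ _)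
      _ ≤ b * ‖y t - p‖ * ‖y t - p‖ := by gcongr; linarith
      _ = _ := by ring
  have hv0 : v 0 = B x x := by
    have : y 0 - p = x := by rw [hy.1, add_sub_cancel_left]
    simp only [hv, this]
  have hd : ∀ t, 0 ≤ t → HasDerivWithinAt v (2 * B (y t - p) (f (y t))) (Ici 0) t :=
    fun t ht => hasDerivWithinAt_form B hB hy ht
  have hcont : ContinuousOn v (Ici 0) := fun t ht => (hd t ht).continuousWithinAt
  have hd' : ∀ t ∈ interior (Ici (0 : ℝ)),
      HasDerivWithinAt v (2 * B (y t - p) (f (y t))) (interior (Ici 0)) t :=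
    fun t ht => (hd t (interior_subset ht)).mono interior_subset
  have hmono : MonotoneOn v (Ici 0) := by
    refine monotoneOn_of_hasDerivWithinAt_nonneg (convex_Ici 0) hcont hd' fun t ht => ?_
    have := h (y t) (hstay t (interior_subset ht))
    have : 0 ≤ η * ‖y t - p‖ ^ 2 := by positivity
    linarith
  set c := 2 * (η * (B x x / b)) with hc
  have hc0 : 0 < c := by positivity
  have hmono' : MonotoneOn (fun t => v t - c * t) (Ici 0) := by
    refine monotoneOn_of_hasDerivWithinAt_nonneg (convex_Ici 0)
      (hcont.sub (by fun_prop)) (fun t ht => (hd' t ht).sub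
        (((hasDerivWithinAt_id t _).const_mul c))) fun t ht => ?_
    have ht0 : (0 : ℝ) ≤ t := interior_subset ht
    have h1 := h (y t) (hstay t ht0)
    have h2 : B x x / b ≤ ‖y t - p‖ ^ 2 := by
      rw [div_le_iff₀ hb0, mul_comm, ← hv0]
      exact (hmono (mem_Ici.2 le_rfl) ht0 ht0).trans (hvb t)
    have h3 : c ≤ 2 * (η * ‖y t - p‖ ^ 2) := by rw [hc]; gcongr
    linarith
  set t := b * ρ ^ 2 / c with ht
  have ht0 : 0 ≤ t := by positivity
  have h1 := hmono' (mem_Ici.2 le_rfl) ht0 ht0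
  have h2 := hvb t
  have h3 : b * ‖y t - p‖ ^ 2 ≤ b * ρ ^ 2 := by
    have := (hstay t ht0).le
    gcongr
  have h4 : c * t = b * ρ ^ 2 := by rw [ht]; field_simp
  simp only [mul_zero, sub_zero, hv0, h4] at h1
  linarith

/-- Barrier argument for `v = -B`: where `v` meets `c ε² exp (-k t)`, the solution is within `ε < ρ`
of `p`, so `v' ≤ -2 k v < -k v` and no crossing occurs. Confinement is thus a conclusion, and
uniqueness of solutions plays no role. -/
theorem exists_exponential_decay_of_form {n : ℕ} {f : Space n → Space n} {p : Space n}
    {B : Space n →L[ℝ] Space n →L[ℝ] ℝ} (hB : ∀ x y, B x y = B y x)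
    {c : ℝ} (hc : 0 < c) (hneg : ∀ x, B x x ≤ -(c * ‖x‖ ^ 2)) {η ρ : ℝ} (hη : 0 < η)
    (h : ∀ x, ‖x - p‖ < ρ → η * ‖x - p‖ ^ 2 ≤ B (x - p) (f x)) :
    ∃ k > 0, ∀ ε > 0, ε < ρ → ∃ δ > 0, ∀ y₀, ‖y₀ - p‖ < δ → ∀ y, IsSolution f y₀ y →
      ∀ t, 0 ≤ t → ‖y t - p‖ ^ 2 ≤ ε ^ 2 * Real.exp (-(k * t)) := by
  set b := ‖B‖ + 1 with hb
  have hb0 : 0 < b := by positivity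
  refine ⟨η / b, by positivity, fun ε hε hερ => ⟨√(c * ε ^ 2 / b), by positivity, ?_⟩⟩
  intro y₀ hy₀ y hy t ht
  set v : ℝ → ℝ := fun t => -B (y t - p) (y t - p) with hv
  have hvb : ∀ t, v t ≤ b * ‖y t - p‖ ^ 2 := fun t => by
    calc v t ≤ ‖B‖ * ‖y t - p‖ * ‖y t - p‖ := (neg_le_abs _).trans (abs_form_apply_le B _ _)
      _ ≤ b * ‖y t - p‖ * ‖y t - p‖ := by gcongr; linarith
      _ = _ := by ring
  have hvc : ∀ t, c * ‖y t - p‖ ^ 2 ≤ v t := fun t => by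
    have := hneg (y t - p)
    simp only [hv]
    linarith
  have hd : ∀ t, 0 ≤ t → HasDerivWithinAt v (-(2 * B (y t - p) (f (y t)))) (Ici 0) t :=
    fun t ht => (hasDerivWithinAt_form B hB hy ht).neg
  have hbd : ∀ t : ℝ, HasDerivAt (fun t => c * ε ^ 2 * Real.exp (-(η / b * t)))
      (-(η / b) * (c * ε ^ 2 * Real.exp (-(η / b * t)))) t := fun t => by
    have h1 : HasDerivAt (fun t : ℝ => -(η / b * t)) (-(η / b * 1)) t :=
      ((hasDerivAt_id t).const_mul (η / b)).neg
    refine (h1.exp.const_mul (c * ε ^ 2)).congr_deriv (by ring)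
  have key := image_le_of_deriv_right_lt_deriv_boundary (f := v) (a := 0) (b := t)
    (fun s hs => ((hd s hs.1).continuousWithinAt).mono Icc_subset_Ici_self)
    (fun s hs => (hd s hs.1).mono (Ici_subset_Ici.2 hs.1)) ?_ hbd ?_ (right_mem_Icc.2 ht)
  · have := (hvc t).trans key
    rw [mul_assoc] at this
    exact le_of_mul_le_mul_left this hc
  · refine (hvb 0).trans ?_
    rw [Real.lt_sqrt (norm_nonneg _), lt_div_iff₀ hb0] at hy₀
    rw [hy.1]
    simp only [mul_zero, neg_zero, Real.exp_zero, mul_one]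
    linarith
  · intro s hs heq
    rw [← heq]
    have hexp : Real.exp (-(η / b * s)) ≤ 1 :=
      Real.exp_le_one_iff.2 (neg_nonpos.2 (mul_nonneg (by positivity) hs.1))
    have h1 : ‖y s - p‖ ^ 2 ≤ ε ^ 2 := by
      have h2 : c * ‖y s - p‖ ^ 2 ≤ c * ε ^ 2 := by
        calc _ ≤ v s := hvc s
          _ = c * ε ^ 2 * Real.exp (-(η / b * s)) := heq
          _ ≤ c * ε ^ 2 * 1 := by gcongr
          _ = _ := mul_one _
      exact le_of_mul_le_mul_left h2 hc
    have h2 : ‖y s - p‖ < ρ := (abs_le_of_sq_le_sq' h1 hε.le).2.trans_lt hερ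
    have h3 := h _ h2
    have hvpos : 0 < v s := by rw [heq]; positivity
    have h4 : η / b * v s ≤ η * ‖y s - p‖ ^ 2 := by
      calc η / b * v s ≤ η / b * (b * ‖y s - p‖ ^ 2) := by gcongr; exact hvb s
        _ = _ := by field_simp
    have h5 : 0 < η / b * v s := by positivity
    linarith

theorem exists_global_solution {n : ℕ} {F : Space n → Space n} {K M : NNReal}
    (hK : LipschitzWith K F) (hM : ∀ x, ‖F x‖ ≤ M) (y₀ : Space n) : ∃ y, IsSolution F y₀ y := by
  have hloc : ∀ N : ℕ, ∃ α : ℝ → Space n, α 0 = y₀ ∧ ∀ t ∈ Icc (0 : ℝ) (N + 1),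
      HasDerivWithinAt α (F (α t)) (Icc (0 : ℝ) (N + 1)) t := by
    intro N
    have hPL : IsPicardLindelof (fun _ => F) (tmin := 0) (tmax := N + 1)
        ⟨0, left_mem_Icc.2 (by positivity)⟩ y₀ (M * (N + 1)) 0 M K :=
      { lipschitzOnWith := fun _ _ => hK.lipschitzOnWith
        continuousOn := fun _ _ => continuousOn_const
        norm_le := fun _ _ x _ => hM x
        mul_max_le := by
          have : (0 : ℝ) ≤ N + 1 := by positivity
          simp [this] }
    exact hPL.exists_eq_forall_mem_Icc_hasDerivWithinAt₀
  choose α hα0 hα using hloc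
  have hright : ∀ N : ℕ, ∀ t ∈ Ico (0 : ℝ) (N + 1), HasDerivWithinAt (α N) (F (α N t)) (Ici t) t :=
    fun N t ht => ((hα N t (Ico_subset_Icc_self ht)).mono
      (Icc_subset_Icc_left ht.1)).mono_of_mem_nhdsWithin (Icc_mem_nhdsGE ht.2)
  have huniq : ∀ N N' : ℕ, N ≤ N' → EqOn (α N) (α N') (Icc (0 : ℝ) (N + 1)) := by
    intro N N' hN
    have hN' : (N : ℝ) ≤ N' := by exact_mod_cast hN
    refine ODE_solution_unique_of_mem_Icc_right (v := fun _ => F) (s := fun _ => univ) (K := K)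
      (fun _ _ => hK.lipschitzOnWith) (fun t ht => (hα N t ht).continuousWithinAt)
      (hright N) (fun _ _ => mem_univ _) ?_ ?_ (fun _ _ => mem_univ _) (by rw [hα0, hα0])
    · have : Icc (0 : ℝ) (N + 1) ⊆ Icc (0 : ℝ) (N' + 1) := Icc_subset_Icc_right (by linarith)
      exact fun t ht => (hα N' t (this ht)).continuousWithinAt.mono this
    · exact fun t ht => hright N' t ⟨ht.1, ht.2.trans_le (by linarith)⟩
  -- Time `t` lies strictly before the endpoint `⌊t⌋₊ + 1` of its piece, and the pieces agree on
  -- overlaps, so derivatives carry over to the glued curve.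
  refine ⟨fun t => α ⌊t⌋₊ t, by simp [hα0], fun t ht => ?_⟩
  have ht : (0 : ℝ) ≤ t := ht
  set N := ⌊t⌋₊ with hN
  have htN : t < N + 1 := Nat.lt_floor_add_one t
  have heq : ∀ s ∈ Ico (0 : ℝ) (N + 1), α ⌊s⌋₊ s = α N s := by
    intro s hs
    have h1 : ⌊s⌋₊ ≤ N := by
      have := (Nat.floor_lt hs.1 (n := N + 1)).2 (by exact_mod_cast hs.2)
      omega
    exact huniq _ _ h1 ⟨hs.1, (Nat.lt_floor_add_one s).le⟩
  have hmem : Ico (0 : ℝ) (N + 1) ∈ 𝓝[Ici 0] t := by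
    rw [← Ici_inter_Iio]
    exact inter_mem_nhdsWithin _ (Iio_mem_nhds htN)
  have hd : HasDerivWithinAt (α N) (F (α N t)) (Ici 0) t :=
    (hα N t ⟨ht, htN.le⟩).mono_of_mem_nhdsWithin (mem_of_superset hmem Ico_subset_Icc_self)
  exact hd.congr_of_eventuallyEq (mem_of_superset hmem heq) rfl

/-- `f` is controlled only near `p`; a compactly supported C¹ field agreeing with it there is
globally Lipschitz and bounded, hence has global solutions. -/
theorem exists_cutoff {n : ℕ} {f : Space n → Space n} {p : Space n} (hf : ContDiffAt ℝ 1 f p) :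
    ∃ (F : Space n → Space n) (K M : NNReal), LipschitzWith K F ∧ (∀ x, ‖F x‖ ≤ M) ∧
      ∃ r > 0, ∀ x, ‖x - p‖ < r → F x = f x := by
  obtain ⟨r, hr, hfr⟩ := Metric.eventually_nhds_iff.1 (hf.eventually (by simp))
  let χ : ContDiffBump p := ⟨r / 4, r / 2, by positivity, by linarith⟩
  set F : Space n → Space n := fun x => χ x • f x with hF
  have hcd : ContDiff ℝ 1 F := by
    rw [contDiff_iff_contDiffAt]
    intro x
    by_cases hx : dist x p < r
    · exact χ.contDiffAt.smul (hfr hx)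
    · have hx' : x ∈ (closedBall p (r / 2))ᶜ := by
        rw [mem_compl_iff, mem_closedBall]
        linarith
      have : F =ᶠ[𝓝 x] fun _ => 0 := by
        filter_upwards [isClosed_closedBall.isOpen_compl.mem_nhds hx'] with z hz
        rw [mem_compl_iff, mem_closedBall, not_le] at hz
        simp [hF, χ.zero_of_le_dist hz.le]
      exact contDiffAt_const.congr_of_eventuallyEq this
  have hsupp : HasCompactSupport F := χ.hasCompactSupport.smul_right
  obtain ⟨K, hK⟩ := ContDiff.lipschitzWith_of_hasCompactSupport hsupp hcd one_ne_zero
  obtain ⟨C, hC⟩ := hsupp.exists_bound_of_continuous hcd.continuous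
  refine ⟨F, K, C.toNNReal, hK, fun x => (hC x).trans (Real.le_coe_toNNReal C), r / 4,
    by positivity, fun x hx => ?_⟩
  have : χ x = 1 := χ.one_of_mem_closedBall (by rw [mem_closedBall, dist_eq_norm]; exact hx.le)
  simp [hF, this]

theorem isLASODE_of_form {n : ℕ} {f : Space n → Space n} {p : Space n} (hf : ContDiffAt ℝ 1 f p)
    {B : Space n →L[ℝ] Space n →L[ℝ] ℝ} (hB : ∀ x y, B x y = B y x)
    {c : ℝ} (hc : 0 < c) (hneg : ∀ x, B x x ≤ -(c * ‖x‖ ^ 2)) {η ρ : ℝ} (hη : 0 < η) (hρ : 0 < ρ)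
    (h : ∀ x, ‖x - p‖ < ρ → η * ‖x - p‖ ^ 2 ≤ B (x - p) (f x)) : IsLASODE f p := by
  obtain ⟨F, K, M, hK, hM, r, hr, hFf⟩ := exists_cutoff hf
  have hF : ∀ x, ‖x - p‖ < min ρ r → η * ‖x - p‖ ^ 2 ≤ B (x - p) (F x) := fun x hx => by
    rw [hFf x (hx.trans_le (min_le_right _ _))]
    exact h x (hx.trans_le (min_le_left _ _))
  obtain ⟨k, hk, hdecay⟩ := exists_exponential_decay_of_form hB hc hneg hη h
  obtain ⟨k', hk', hdecay'⟩ := exists_exponential_decay_of_form hB hc hneg hη hF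
  have hexp : ∀ k > 0, ∀ t : ℝ, 0 ≤ t → Real.exp (-(k * t)) ≤ 1 := fun k hk t ht =>
    Real.exp_le_one_iff.2 (neg_nonpos.2 (mul_nonneg (le_of_lt hk) ht))
  have hle : ∀ k > 0, ∀ t : ℝ, 0 ≤ t → ∀ ε > 0, ∀ x : Space n,
      ‖x‖ ^ 2 ≤ ε ^ 2 * Real.exp (-(k * t)) → ‖x‖ ≤ ε := by
    intro k hk t ht ε hε x hx
    refine (abs_le_of_sq_le_sq' (hx.trans ?_) (le_of_lt hε)).2
    exact mul_le_of_le_one_right (sq_nonneg _) (hexp k hk t ht)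
  have hr' : 0 < min ρ r := lt_min hρ hr
  -- This confines solutions of the cut-off field to the region where it equals `f`, so they solve
  -- the original system: this is the existence half of stability.
  obtain ⟨δ', hδ', hd'⟩ := hdecay' (min ρ r / 2) (by positivity) (by linarith)
  refine ⟨fun ε hε => ?_, ?_⟩
  · have hε' : 0 < min ε ρ / 2 := by positivity
    have h1 := min_le_left ε ρ
    have h2 := min_le_right ε ρ
    obtain ⟨δ, hδ, hd⟩ := hdecay (min ε ρ / 2) hε' (by linarith)
    refine ⟨min δ δ', lt_min hδ hδ', fun y₀ hy₀ => ⟨?_, fun y hy t ht => ?_⟩⟩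
    · obtain ⟨y, hy⟩ := exists_global_solution hK hM y₀
      refine ⟨y, hy.1, fun t ht => ?_⟩
      have h3 := hd' y₀ (hy₀.trans_le (min_le_right _ _)) y hy t ht
      have h4 := hle k' hk' t ht _ (by positivity) _ h3
      have h5 := min_le_right ρ r
      have h6 := hy.2 t ht
      simp only at h6 ⊢
      rwa [hFf (y t) (by linarith)] at h6
    · have h3 := hle k hk t ht _ hε' _ (hd y₀ (hy₀.trans_le (min_le_left _ _)) y hy t ht)
      linarith
  · obtain ⟨δ, hδ, hd⟩ := hdecay (ρ / 2) (by positivity) (by linarith)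
    refine ⟨δ, hδ, fun y₀ hy₀ y hy => ?_⟩
    rw [tendsto_iff_norm_sub_tendsto_zero]
    have hlim : Tendsto (fun t : ℝ => √((ρ / 2) ^ 2 * Real.exp (-(k * t)))) atTop (𝓝 0) := by
      have h1 : Tendsto (fun t : ℝ => Real.exp (-(k * t))) atTop (𝓝 0) :=
        Real.tendsto_exp_neg_atTop_nhds_zero.comp (tendsto_id.const_mul_atTop hk)
      simpa using (h1.const_mul ((ρ / 2) ^ 2)).sqrt
    refine squeeze_zero' (Eventually.of_forall fun _ => norm_nonneg _) ?_ hlim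
    filter_upwards [eventually_ge_atTop 0] with t ht
    exact Real.le_sqrt_of_sq_le (hd y₀ hy₀ y hy t ht)

theorem isLASMap_of_form {n : ℕ} {g : Space n → Space n} {p : Space n}
    {B : Space n →L[ℝ] Space n →L[ℝ] ℝ} {c : ℝ} (hc : 0 < c)
    (hneg : ∀ x, B x x ≤ -(c * ‖x‖ ^ 2)) {η ρ : ℝ} (hη : 0 < η) (hρ : 0 < ρ)
    (h : ∀ x, ‖x - p‖ < ρ → B (x - p) (x - p) + η * ‖x - p‖ ^ 2 ≤ B (g x - p) (g x - p)) :
    IsLASMap g p := by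
  -- The summand `η` ensures `η / b < 1`, so the contraction factor `κ` is positive.
  set b := ‖B‖ + 1 + η with hb
  have hb0 : 0 < b := by positivity
  have hBb : ∀ x, -B x x ≤ b * ‖x‖ ^ 2 := fun x => by
    calc -B x x ≤ ‖B‖ * ‖x‖ * ‖x‖ := (neg_le_abs _).trans (abs_form_apply_le B _ _)
      _ ≤ b * ‖x‖ * ‖x‖ := by gcongr; linarith
      _ = _ := by ring
  set κ := 1 - η / b with hκ
  have hκ0 : 0 < κ := by
    rw [hκ, sub_pos, div_lt_one hb0]
    linarith [norm_nonneg B]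
  have hκ1 : κ < 1 := by
    have : 0 < η / b := by positivity
    linarith
  have hstep : ∀ x, ‖x - p‖ < ρ → -B (g x - p) (g x - p) ≤ κ * -B (x - p) (x - p) := by
    intro x hx
    have h1 := h x hx
    have h2 : η / b * -B (x - p) (x - p) ≤ η * ‖x - p‖ ^ 2 := by
      calc _ ≤ η / b * (b * ‖x - p‖ ^ 2) := by gcongr; exact hBb _
        _ = _ := by field_simp
    rw [hκ, sub_mul, one_mul]
    linarith
  have key : ∀ ε > 0, ε ≤ ρ → ∃ δ > 0, ∀ y₀, ‖y₀ - p‖ < δ →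
      ∀ k : ℕ, ‖g^[k] y₀ - p‖ ^ 2 < ε ^ 2 * κ ^ k := by
    intro ε hε hερ
    refine ⟨√(c * ε ^ 2 / b), by positivity, fun y₀ hy₀ k => ?_⟩
    rw [Real.lt_sqrt (norm_nonneg _), lt_div_iff₀ hb0] at hy₀
    have hof : ∀ k x, -B (x - p) (x - p) < c * ε ^ 2 * κ ^ k → ‖x - p‖ ^ 2 < ε ^ 2 * κ ^ k := by
      intro k x hx
      have h1 := hneg (x - p)
      refine lt_of_mul_lt_mul_left (a := c) ?_ hc.le
      linarith
    refine hof k _ ?_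
    induction k with
    | zero =>
      simp only [Function.iterate_zero, id, pow_zero, mul_one]
      linarith [hBb (y₀ - p)]
    | succ k ih =>
      have h1 : ‖g^[k] y₀ - p‖ ^ 2 < ρ ^ 2 := by
        calc _ < ε ^ 2 * κ ^ k := hof k _ ih
          _ ≤ ε ^ 2 * 1 := by gcongr; exact pow_le_one₀ hκ0.le hκ1.le
          _ ≤ ρ ^ 2 := by rw [mul_one]; gcongr
      have h2 := hstep _ (lt_of_pow_lt_pow_left₀ 2 hρ.le h1)
      rw [Function.iterate_succ_apply', pow_succ]
      calc _ ≤ _ := h2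
        _ < κ * (c * ε ^ 2 * κ ^ k) := by gcongr
        _ = _ := by ring
  refine ⟨fun ε hε => ?_, ?_⟩
  · obtain ⟨δ, hδ, hd⟩ := key (min ε ρ) (lt_min hε hρ) (min_le_right _ _)
    refine ⟨δ, hδ, fun y₀ hy₀ k => ?_⟩
    refine lt_of_lt_of_le (lt_of_pow_lt_pow_left₀ 2 (lt_min hε hρ).le ((hd y₀ hy₀ k).trans_le ?_))
      (min_le_left _ _)
    exact mul_le_of_le_one_right (sq_nonneg _) (pow_le_one₀ hκ0.le hκ1.le)
  · obtain ⟨δ, hδ, hd⟩ := key ρ hρ le_rfl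
    refine ⟨δ, hδ, fun y₀ hy₀ => ?_⟩
    rw [tendsto_iff_norm_sub_tendsto_zero]
    have hlim : Tendsto (fun k : ℕ => √(ρ ^ 2 * κ ^ k)) atTop (𝓝 0) := by
      simpa using ((tendsto_pow_atTop_nhds_zero_of_lt_one hκ0.le hκ1).const_mul (ρ ^ 2)).sqrt
    exact squeeze_zero (fun _ => norm_nonneg _)
      (fun k => Real.le_sqrt_of_sq_le (hd y₀ hy₀ k).le) hlim

/-- Discrete analogue of the flow argument: a confined orbit starting with `B > 0` would gain at
least `c` in `B` at every step. -/
theorem not_isStableMap_of_form {n : ℕ} {g : Space n → Space n} {p : Space n}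
    {B : Space n →L[ℝ] Space n →L[ℝ] ℝ} (hpos : ∃ x, 0 < B x x)
    {η ρ r : ℝ} (hη : 0 < η) (hρ : 0 < ρ) (hr : 1 ≤ r)
    (h : ∀ x, ‖x - p‖ < ρ →
      r ^ 2 * B (x - p) (x - p) + η * ‖x - p‖ ^ 2 ≤ B (g x - p) (g x - p)) :
    ¬ IsStableMap g p := by
  intro hst
  obtain ⟨δ, hδ, hst⟩ := hst ρ hρ
  obtain ⟨x, hxδ, hx⟩ := exists_small_pos B hpos hδ
  have hstay := hst (p + x) (by simpa using hxδ)
  set b := ‖B‖ + 1 with hb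
  have hb0 : 0 < b := by positivity
  have hBb : ∀ x, B x x ≤ b * ‖x‖ ^ 2 := fun x => by
    calc B x x ≤ ‖B‖ * ‖x‖ * ‖x‖ := (le_abs_self _).trans (abs_form_apply_le B _ _)
      _ ≤ b * ‖x‖ * ‖x‖ := by gcongr; linarith
      _ = _ := by ring
  set c := η * (B x x / b) with hc
  have hc0 : 0 < c := by positivity
  have key : ∀ k : ℕ, B x x + k * c ≤ B (g^[k] (p + x) - p) (g^[k] (p + x) - p) := by
    intro k
    induction k with
    | zero => simp
    | succ k ih =>
      rw [Function.iterate_succ_apply']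
      have h1 := h _ (hstay k)
      set u := g^[k] (p + x) - p
      have hk : 0 ≤ k * c := by positivity
      have h2 : B x x ≤ B u u := by linarith
      have h3 : c ≤ η * ‖u‖ ^ 2 := by
        rw [hc]
        gcongr
        rw [div_le_iff₀ hb0, mul_comm]
        exact h2.trans (hBb u)
      have h4 : B u u ≤ r ^ 2 * B u u := le_mul_of_one_le_left (by linarith) (one_le_pow₀ hr)
      push_cast
      linarith
  obtain ⟨k, hk⟩ := exists_nat_gt (b * ρ ^ 2 / c)
  rw [div_lt_iff₀ hc0] at hk
  have h1 := key k
  have h2 := hBb (g^[k] (p + x) - p)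
  have h3 : b * ‖g^[k] (p + x) - p‖ ^ 2 ≤ b * ρ ^ 2 := by
    have := (hstay k).le
    gcongr
  linarith

end NSFD

/-! ### Linearization theorems and the spectrum of the scheme -/

namespace NSFD

theorem represents_fderiv {n : ℕ} (f : Space n → Space n) (p : Space n) :
    Represents ((jacobian f p).map (algebraMap ℝ ℂ)) (fderiv ℝ f p) := by
  intro x
  have hx : x = ∑ j, x j • EuclideanSpace.single j (1 : ℝ) := by
    ext i
    simp [Pi.single_apply]
  ext i
  have h : (fderiv ℝ f p x) i = ∑ j, x j * (fderiv ℝ f p (EuclideanSpace.single j 1)) i := by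
    conv_lhs => rw [hx, map_sum]
    simp
  rw [complexify_apply, h]
  simp [Matrix.mulVec, dotProduct, jacobian, mul_comm]

theorem isLASODE_of_re_neg {n : ℕ} {f : Space n → Space n} {p : Space n}
    (hf : ContDiffAt ℝ 1 f p) (hp : f p = 0) (h : ∀ l ∈ jacobianEigenvalues f p, l.re < 0) :
    IsLASODE f p := by
  have hd : HasFDerivAt f (fderiv ℝ f p) p := (hf.differentiableAt one_ne_zero).hasFDerivAt
  obtain ⟨B, hB, ⟨η, hη, hBA⟩, hneg⟩ := exists_form_flow (represents_fderiv f p)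
    fun l hl => (h l hl).ne
  obtain ⟨c, hc, hneg⟩ := hneg h
  obtain ⟨ρ, hρ, hloc⟩ := exists_flow_remainder_le hd hp B hη hBA
  exact isLASODE_of_form hf hB hc hneg (half_pos hη) hρ hloc

theorem re_neg_of_isStableODE {n : ℕ} {f : Space n → Space n} {p : Space n}
    (hf : ContDiffAt ℝ 1 f p) (hp : f p = 0) (hhyp : IsHyperbolic f p) (hst : IsStableODE f p) :
    ∀ l ∈ jacobianEigenvalues f p, l.re < 0 := by
  intro l hl
  by_contra! hre
  have hd : HasFDerivAt f (fderiv ℝ f p) p := (hf.differentiableAt one_ne_zero).hasFDerivAt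
  obtain ⟨B, hB, ⟨η, hη, hBA⟩, -⟩ := exists_form_flow (represents_fderiv f p) hhyp
  obtain ⟨ρ, hρ, hloc⟩ := exists_flow_remainder_le hd hp B hη hBA
  have hpos := exists_pos_of_flow (represents_fderiv f p) hB hη hBA hl (hre.lt_of_ne' (hhyp l hl))
  exact not_isStableODE_of_form hB hpos (half_pos hη) hρ hloc hst

theorem isLASMap_of_norm_lt_one {n : ℕ} {g : Space n → Space n} {A : Space n →L[ℝ] Space n}
    {M : Matrix (Fin n) (Fin n) ℂ} {p : Space n} (hg : HasFDerivAt g A p) (hp : g p = p)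
    (hA : Represents M A) (h : ∀ l ∈ spectrum ℂ M, ‖l‖ < 1) : IsLASMap g p := by
  obtain ⟨B, hB, ⟨η, hη, hBA⟩, hneg⟩ := exists_form_iterate hA one_pos fun l hl => (h l hl).ne
  obtain ⟨c, hc, hneg⟩ := hneg h
  obtain ⟨ρ, hρ, hloc⟩ := exists_iterate_remainder_le hg hp B hη hBA
  refine isLASMap_of_form hc hneg (half_pos hη) hρ fun x hx => ?_
  simpa using hloc x hx

/-- Other eigenvalues may lie on the unit circle: `m_S` ignores saddles, whose stable eigenvalues
can land there. A radius `r` strictly between 1 and `‖l‖` that avoids the finitely many moduli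
replaces hyperbolicity of the map. -/
theorem not_isStableMap_of_one_lt_norm {n : ℕ} {g : Space n → Space n}
    {A : Space n →L[ℝ] Space n} {M : Matrix (Fin n) (Fin n) ℂ} {p : Space n}
    (hg : HasFDerivAt g A p) (hp : g p = p) (hA : Represents M A) {l : ℂ}
    (hl : l ∈ spectrum ℂ M) (h : 1 < ‖l‖) : ¬ IsStableMap g p := by
  obtain ⟨r, ⟨hr1, hrl⟩, hr⟩ := (Set.Ioo_infinite h).exists_notMem_finite
    ((Matrix.finite_spectrum M).image norm)
  have hr0 : 0 < r := one_pos.trans hr1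
  obtain ⟨B, hB, ⟨η, hη, hBA⟩, -⟩ := exists_form_iterate hA hr0
    fun l hl hlr => hr ⟨l, hl, hlr⟩
  obtain ⟨ρ, hρ, hloc⟩ := exists_iterate_remainder_le hg hp B hη hBA
  exact not_isStableMap_of_form (exists_pos_of_iterate hA hB hη hr0 hBA hl hrl) (half_pos hη) hρ
    hr1.le hloc

theorem hasFDerivAt_scheme {n : ℕ} {f : Space n → Space n} {A : Space n →L[ℝ] Space n}
    {p : Space n} (hf : HasFDerivAt f A p) (m c : ℝ) :
    HasFDerivAt (scheme f m c) (1 + (c / (1 + m * c)) • A) p :=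
  (hasFDerivAt_id p).add (hf.const_smul (c / (1 + m * c)))

theorem Represents.one_add_smul {n : ℕ} {M : Matrix (Fin n) (Fin n) ℂ}
    {A : Space n →L[ℝ] Space n} (hA : Represents M A) (s : ℝ) :
    Represents (1 + (s : ℂ) • M) (1 + s • A) := by
  intro x
  have hx : (1 + s • A) x = x + s • A x := rfl
  rw [hx, map_add, map_smul, hA x, Matrix.add_mulVec, Matrix.one_mulVec, Matrix.smul_mulVec]
  ext i
  simp

theorem mem_spectrum_one_add_smul {n : ℕ} (M : Matrix (Fin n) (Fin n) ℂ) {s : ℂ} (hs : s ≠ 0)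
    (l : ℂ) : 1 + s * l ∈ spectrum ℂ (1 + s • M) ↔ l ∈ spectrum ℂ M := by
  rw [spectrum.mem_iff, spectrum.mem_iff, not_iff_not]
  have : algebraMap ℂ (Matrix (Fin n) (Fin n) ℂ) (1 + s * l) - (1 + s • M) =
      Units.mk0 s hs • (algebraMap ℂ _ l - M) := by
    rw [map_add, map_one, map_mul, Units.smul_mk0, smul_sub, ← Algebra.smul_def]
    abel
  rw [this, isUnit_smul_iff]

theorem norm_one_add_mul_sq (s : ℝ) (l : ℂ) :
    ‖1 + (s : ℂ) * l‖ ^ 2 = 1 + s * (2 * l.re + s * ‖l‖ ^ 2) := by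
  rw [← Complex.normSq_eq_norm_sq, ← Complex.normSq_eq_norm_sq, Complex.normSq_apply,
    Complex.normSq_apply]
  simp
  ring

/-- This yields `m ≥ 0`, so `1 + m φ` is positive for every step size. -/
theorem stabilityThreshold_nonneg {n : ℕ} {f : Space n → Space n}
    (h : ∀ l ∈ stableEigenvalues f, l.re < 0) : 0 ≤ stabilityThreshold f := by
  refine Real.sSup_nonneg ?_
  rintro _ ⟨l, hl, rfl⟩
  exact div_nonneg_of_nonpos (neg_nonpos.2 (sq_nonneg _)) (by linarith [h l hl])

theorem norm_one_add_mul_lt_one {l : ℂ} (hl : l.re < 0) {m c : ℝ} (hc : 0 < c) (hm : 0 ≤ m)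
    (hlm : -‖l‖ ^ 2 / (2 * l.re) ≤ m) : ‖1 + ((c / (1 + m * c) : ℝ) : ℂ) * l‖ < 1 := by
  have hmc : 0 < 1 + m * c := by positivity
  have hs : 0 < c / (1 + m * c) := by positivity
  have hsq : ‖l‖ ^ 2 ≤ m * -(2 * l.re) := by
    rw [← neg_div_neg_eq, neg_neg, div_le_iff₀ (by linarith)] at hlm
    exact hlm
  have h1 : c / (1 + m * c) * ‖l‖ ^ 2 < -(2 * l.re) := by
    rw [div_mul_eq_mul_div, div_lt_iff₀ hmc]
    -- `c ‖l‖² ≤ c m (-2 Re l) < (1 + m c) (-2 Re l)`: strict even at equality in the threshold.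
    nlinarith
  refine lt_of_pow_lt_pow_left₀ 2 one_pos.le ?_
  rw [norm_one_add_mul_sq, one_pow]
  nlinarith

theorem one_lt_norm_one_add_mul {l : ℂ} (hl : 0 < l.re) {s : ℝ} (hs : 0 < s) :
    1 < ‖1 + (s : ℂ) * l‖ := by
  refine lt_of_lt_of_le ?_ (Complex.re_le_norm _)
  simpa using mul_pos hs hl

end NSFD

theorem theorem4p1 {n : ℕ} (f : NSFD.Space n → NSFD.Space n)
    (hf : ∀ p ∈ NSFD.equilibria f, ContDiffAt ℝ 1 f p)
    (hfin : (NSFD.equilibria f).Finite)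
    (hhyp : ∀ p ∈ NSFD.equilibria f, NSFD.IsHyperbolic f p)
    (φ : ℝ → ℝ) (hφ : NSFD.IsDenominatorFunction φ)
    (m : ℝ) (hm : NSFD.stabilityThreshold f ≤ m) :
    ∀ h : ℝ, 0 < h → ∀ p ∈ NSFD.equilibria f,
      Function.IsFixedPt (NSFD.scheme f m (φ h)) p ∧
      (NSFD.IsStableODE f p → NSFD.IsLASMap (NSFD.scheme f m (φ h)) p) ∧
      (¬ NSFD.IsStableODE f p → ¬ NSFD.IsStableMap (NSFD.scheme f m (φ h)) p) := by
  intro h hh p hp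
  have hc : 0 < φ h := hφ.pos h hh
  have hp0 : f p = 0 := hp
  have hre : ∀ l ∈ NSFD.stableEigenvalues f, l.re < 0 := by
    intro l hl
    simp only [NSFD.stableEigenvalues, Set.mem_iUnion, Set.mem_ofPred_eq] at hl
    obtain ⟨q, ⟨hq, hLAS⟩, hl⟩ := hl
    exact NSFD.re_neg_of_isStableODE (hf q hq) hq (hhyp q hq) hLAS.1 l hl
  have hm0 : 0 ≤ m := (NSFD.stabilityThreshold_nonneg hre).trans hm
  have hs : 0 < φ h / (1 + m * φ h) := by positivity
  have hs' : ((φ h / (1 + m * φ h) : ℝ) : ℂ) ≠ 0 := by exact_mod_cast hs.ne'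
  have hfix : NSFD.scheme f m (φ h) p = p := by simp [NSFD.scheme, hp0]
  have hd := NSFD.hasFDerivAt_scheme
    (((hf p hp).differentiableAt one_ne_zero).hasFDerivAt) m (φ h)
  have hA := (NSFD.represents_fderiv f p).one_add_smul (φ h / (1 + m * φ h))
  refine ⟨hfix, fun hst => ?_, fun hunst => ?_⟩
  · have hneg := NSFD.re_neg_of_isStableODE (hf p hp) hp (hhyp p hp) hst
    -- Stability is upgraded to LAS, so that the eigenvalues at `p` enter the maximum defining
    -- `m_S`.
    have hLAS := NSFD.isLASODE_of_re_neg (hf p hp) hp hneg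
    refine NSFD.isLASMap_of_norm_lt_one hd hfix hA fun l hl => ?_
    obtain ⟨l, rfl⟩ : ∃ l', l = 1 + ((φ h / (1 + m * φ h) : ℝ) : ℂ) * l' :=
      ⟨(l - 1) / _, by rw [mul_div_cancel₀ _ hs']; ring⟩
    rw [NSFD.mem_spectrum_one_add_smul _ hs'] at hl
    have hmem : l ∈ NSFD.stableEigenvalues f := Set.mem_biUnion ⟨hp, hLAS⟩ hl
    refine NSFD.norm_one_add_mul_lt_one (hneg l hl) hc hm0 (le_trans ?_ hm)
    exact (NSFD.isGreatest_stabilityThreshold f hfin ⟨l, hmem⟩).2 ⟨l, hmem, rfl⟩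
  · obtain ⟨l, hl, hre⟩ : ∃ l ∈ NSFD.jacobianEigenvalues f p, 0 < l.re := by
      -- Without such an eigenvalue, hyperbolicity makes all real parts negative, and `p` would be
      -- stable.
      by_contra! hle
      exact hunst (NSFD.isLASODE_of_re_neg (hf p hp) hp
        fun l hl => (hle l hl).lt_of_ne (hhyp p hp l hl)).1
    exact NSFD.not_isStableMap_of_one_lt_norm hd hfix hA
      ((NSFD.mem_spectrum_one_add_smul _ hs' l).2 hl) (NSFD.one_lt_norm_one_add_mul hre hs)
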